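/- Fix a polynomial vector field $F=(f_1,\dots,f_N)$ with $f_i\in\mathbb R[\mathbf x]$, $\mathbf x=(x_1,\dots,x_N)$. For $P\subseteq\mathbb R[\mathbf x]$ let $\mathbf V(P)\subseteq\mathbb R^N$ be the set of common real zeros of $P$; sets of this form are the algebraic varieties. For $A\subseteq\mathbb R^N$ let $\mathbf I(A)$ be the ideal of the polynomials vanishing on $A$. For $\mathbf x_0\in\mathbb R^N$ let $\mathbf x(t;\mathbf x_0)$ be the solution of $\dot{\mathbf x}=F(\mathbf x)$, $\mathbf x(0)=\mathbf x_0$, on the largest symmetric open interval $D_{\mathbf x_0}$ around $0$ on which the Taylor expansions from $0$ of all its components converge. An algebraic variety $\chi$ is an algebraic invariant if $\mathbf x(t;\mathbf x_0)\in\chi$ for all $\mathbf x_0\in\chi$ and $t\in D_{\mathbf x_0}$. Let $\mathbf a=(a_1,\dots,a_n)$ be parameters. A template is a polynomial $\pi\in\mathbb R[\mathbf a,\mathbf x]$ whose coefficients, as a polynomial in $\mathbf x$, are linear forms in $\mathbf a$ without constant term; $\pi[v]\in\mathbb R[\mathbf x]$ is the result of substituting $v\in\mathbb R^n$ for $\mathbf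 a$, and $\pi[S]=\{\pi[v]:v\in S\}$ for $S\subseteq\mathbb R^n$. Let $\pi^{(0)}=\pi$ and $\pi^{(j+1)}=\sum_{i=1}^N \frac{\partial \pi^{(j)}}{\partial x_i} f_i$. Fix a monomial order on $\mathbb R[\mathbf a,\mathbf x]$ that is an elimination order for $\mathbf a$ (every monomial containing some $a_i$ is larger than every monomial in $\mathbf x$ only), for instance a lexicographic order with $a_i>x_j$ for all $i,j$. For an algebraic variety $\psi$ and a template $\pi$, let $G\subseteq\mathbb R[\mathbf x]$ be a Gröbner basis of $\mathbf I(\psi)$ with respect to the restriction of this order to the monomials in $\mathbf x$, let $r_j=\pi^{(j)}\bmod G$ be the remainder of the division in $\mathbb R[\mathbf a,\mathbf x]$, and for $i\ge 0$ let $$V_i=\{v\in\mathbb R^n: r_j[v]=0 \text{ for } j=0,\dots,i\},\qquad J_i=\Big\langle \bigcup_{j=0}^i \pi^{(j)}[V_i]\Big\rangle\subseteq\mathbb R[\mathbf x].$$ Then there is an $m\ge 0$ with $V_{m+1}=V_m$ and $J_{m+1}=J_m$. Taking the least such $m$, let $\mathrm{POST}(\psi,\pi)=(V,J)=(V_m,J_m)$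 and $\phi=\mathbf V(\pi[V])$. Then $\mathbf V(J)$ is the largest (with respect to inclusion) algebraic invariant contained in $\phi$. -/

import Mathlib

open MvPolynomial

namespace PolyODE

noncomputable section

/-! ### Polynomial division and Gröbner bases over `ℝ` -/

/-- `r` is a remainder of the multivariate division of `f` by the set `G`, with respect to the
monomial order `m`: `f = ∑ h_g * g + r`, no product `h_g * g` exceeds the multidegree of `f`, and
no monomial of `r` is divisible by the leading monomial of a nonzero element of `G`. -/
def IsRemainder {σ : Type*} (m : MonomialOrder σ) (G : Set (MvPolynomial σ ℝ))
    (f r : MvPolynomial σ ℝ) : Prop :=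
  ∃ h : G →₀ MvPolynomial σ ℝ,
    f = Finsupp.linearCombination (MvPolynomial σ ℝ) (fun g : G => (g : MvPolynomial σ ℝ)) h + r ∧
    (∀ g : G, m.toSyn (m.degree ((g : MvPolynomial σ ℝ) * h g)) ≤ m.toSyn (m.degree f)) ∧
    ∀ c ∈ r.support, ∀ g ∈ G, g ≠ 0 → ¬ m.degree g ≤ c

theorem exists_isRemainder {σ : Type*} (m : MonomialOrder σ) (G : Set (MvPolynomial σ ℝ))
    (f : MvPolynomial σ ℝ) : ∃ r, IsRemainder m G f r := by
  classical
  obtain ⟨h, r, hf, hd, hr⟩ := m.div (b := fun g : {g : G // (g : MvPolynomial σ ℝ) ≠ 0} =>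
    (g.1 : MvPolynomial σ ℝ))
    (fun g => by simpa [MonomialOrder.leadingCoeff_eq_zero_iff] using g.2) f
  refine ⟨r, h.embDomain (Function.Embedding.subtype _), ?_, ?_, ?_⟩
  · rw [Finsupp.linearCombination_embDomain]
    exact hf
  · intro g
    by_cases hg : (g : MvPolynomial σ ℝ) = 0
    · simp [hg]
    · have := hd ⟨g, hg⟩
      have e := Finsupp.embDomain_apply_self
        (Function.Embedding.subtype fun g : G => (g : MvPolynomial σ ℝ) ≠ 0) h ⟨g, hg⟩
      simp only [Function.Embedding.subtype_apply] at e
      rw [e]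
      exact this
  · intro c hc g hg hg0
    exact hr c hc ⟨⟨g, hg⟩, hg0⟩

/-- The remainder `f mod G`. It is uniquely determined by `IsRemainder` when `G` is a
Gröbner basis. -/
def remainder {σ : Type*} (m : MonomialOrder σ) (G : Set (MvPolynomial σ ℝ))
    (f : MvPolynomial σ ℝ) : MvPolynomial σ ℝ :=
  (exists_isRemainder m G f).choose

/-- `G` is a Gröbner basis of the ideal `I` with respect to `m`: a finite basis of `I` such that
a polynomial belongs to `I` exactly when its remainder on division by `G` is zero. -/
structure IsGroebnerBasis {σ : Type*} (m : MonomialOrder σ) (G : Set (MvPolynomial σ ℝ))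
    (I : Ideal (MvPolynomial σ ℝ)) : Prop where
  finite : G.Finite
  span_eq : Ideal.span G = I
  mem_iff : ∀ p r, IsRemainder m G p r → (p ∈ I ↔ r = 0)

/-! ### Monomial orders on `ℝ[a, x]`

The parameters `a` are indexed by the left summand, the variables `x` by the right one. -/

/-- `M` is an elimination order for the parameters: every monomial in which a parameter occurs is
larger than every monomial in the variables `x` alone. -/
def IsEliminationOrder {n N : ℕ} (M : MonomialOrder (Fin n ⊕ Fin N)) : Prop :=
  ∀ (s : Fin n ⊕ Fin N →₀ ℕ) (t : Fin N →₀ ℕ), (∃ i, s (Sum.inl i) ≠ 0) →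
    M.toSyn (t.mapDomain Sum.inr) < M.toSyn s

theorem toSyn_mapDomain_inr_injective {n N : ℕ} (M : MonomialOrder (Fin n ⊕ Fin N)) :
    Function.Injective fun t : Fin N →₀ ℕ => M.toSyn (t.mapDomain Sum.inr) :=
  fun _ _ h => Finsupp.mapDomain_injective Sum.inr_injective (M.toSyn.injective h)

/-- The restriction to the monomials in `x` of a monomial order on the monomials in `(a, x)`. -/
@[reducible]
def restrictOrder {n N : ℕ} (M : MonomialOrder (Fin n ⊕ Fin N)) : MonomialOrder (Fin N) :=
  letI L : LinearOrder (Fin N →₀ ℕ) := LinearOrder.lift' _ (toSyn_mapDomain_inr_injective M)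
  { syn := Fin N →₀ ℕ
    addCommMonoidSyn := inferInstance
    linearOrderSyn := L
    isOrderedAddMonoid_syn :=
      @IsOrderedAddMonoid.mk (Fin N →₀ ℕ) _ L.toPreorder
        (fun a b h c => by
          change M.toSyn ((a + c).mapDomain Sum.inr) ≤ M.toSyn ((b + c).mapDomain Sum.inr)
          change M.toSyn (a.mapDomain Sum.inr) ≤ M.toSyn (b.mapDomain Sum.inr) at h
          rw [Finsupp.mapDomain_add, Finsupp.mapDomain_add, map_add, map_add]
          exact add_le_add_left h _)
        (fun a b h c => by
          change M.toSyn ((c + a).mapDomain Sum.inr) ≤ M.toSyn ((c + b).mapDomain Sum.inr)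
          change M.toSyn (a.mapDomain Sum.inr) ≤ M.toSyn (b.mapDomain Sum.inr) at h
          rw [Finsupp.mapDomain_add, Finsupp.mapDomain_add, map_add, map_add]
          exact add_le_add_right h _)
    toSyn := AddEquiv.refl _
    toSyn_monotone := fun a b h => by
      change M.toSyn (a.mapDomain Sum.inr) ≤ M.toSyn (b.mapDomain Sum.inr)
      obtain ⟨c, rfl⟩ := exists_add_of_le h
      rw [Finsupp.mapDomain_add, map_add]
      exact M.le_add_right _ _
    wellFoundedLT_syn :=
      ⟨InvImage.wf (fun t : Fin N →₀ ℕ => M.toSyn (t.mapDomain Sum.inr)) wellFounded_lt⟩ }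

/-! ### Algebraic varieties -/

/-- The set of common real zeros of a set `P` of polynomials. -/
def variety {N : ℕ} (P : Set (MvPolynomial (Fin N) ℝ)) : Set (Fin N → ℝ) :=
  {x | ∀ p ∈ P, eval x p = 0}

def IsAlgebraicVariety {N : ℕ} (χ : Set (Fin N → ℝ)) : Prop :=
  ∃ P : Set (MvPolynomial (Fin N) ℝ), χ = variety P

/-! ### Trajectories, safety assertions and algebraic invariants -/

/-- `x`, on the interval `D = {t | |t| < R}`, is the time trajectory from `x₀` of the polynomial
vector field `F`: it solves the initial value problem on `D`, it is there the sum of its Taylor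
expansion from `0`, and `D` is the largest symmetric open interval on which the Taylor expansions
of all the components converge. -/
structure IsTimeTrajectory {N : ℕ} (F : Fin N → MvPolynomial (Fin N) ℝ) (x₀ : Fin N → ℝ)
    (R : ENNReal) (x : ℝ → Fin N → ℝ) : Prop where
  pos : 0 < R
  init : x 0 = x₀
  ode : ∀ t : ℝ, ENNReal.ofReal |t| < R → HasDerivAt x (fun i => eval (x t) (F i)) t
  taylor : ∀ t : ℝ, ENNReal.ofReal |t| < R → ∀ i : Fin N,
    HasSum (fun k : ℕ => iteratedDeriv k (fun s => x s i) 0 / (k.factorial : ℝ) * t ^ k) (x t i)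
  maximal : ∀ S : ENNReal,
    (∀ t : ℝ, ENNReal.ofReal |t| < S → ∀ i : Fin N,
      Summable fun k : ℕ => iteratedDeriv k (fun s => x s i) 0 / (k.factorial : ℝ) * t ^ k) →
    S ≤ R

/-- The safety assertion `ψ → [F] φ`: every time trajectory that starts in `ψ` stays in `φ`. -/
def Safe {N : ℕ} (F : Fin N → MvPolynomial (Fin N) ℝ) (ψ φ : Set (Fin N → ℝ)) : Prop :=
  ∀ x₀ ∈ ψ, ∀ (R : ENNReal) (x : ℝ → Fin N → ℝ), IsTimeTrajectory F x₀ R x →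
    ∀ t : ℝ, ENNReal.ofReal |t| < R → x t ∈ φ

/-- An algebraic variety `χ` with `χ → [F] χ`. -/
def IsAlgebraicInvariant {N : ℕ} (F : Fin N → MvPolynomial (Fin N) ℝ) (χ : Set (Fin N → ℝ)) :
    Prop :=
  IsAlgebraicVariety χ ∧ Safe F χ χ

/-! ### Templates -/

/-- A polynomial in `ℝ[a, x]` that is a template, i.e. whose coefficients, as a polynomial in `x`,
are linear forms (without constant term) in the parameters `a`: each of its monomials has
degree exactly one in `a`. -/
def IsTemplate {n N : ℕ} (π : MvPolynomial (Fin n ⊕ Fin N) ℝ) : Prop :=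
  ∀ c ∈ π.support, ∑ i : Fin n, c (Sum.inl i) = 1

/-- The polynomial `π[v] ∈ ℝ[x]` obtained by giving to the parameters the values `v`. -/
def instantiate {n N : ℕ} (π : MvPolynomial (Fin n ⊕ Fin N) ℝ) (v : Fin n → ℝ) :
    MvPolynomial (Fin N) ℝ :=
  aeval (Sum.elim (fun i => C (v i)) X : Fin n ⊕ Fin N → MvPolynomial (Fin N) ℝ) π

/-- The formal Lie derivative along `F` of a polynomial in `ℝ[a, x]`, the parameters being
treated as constants. -/
def templateLie {n N : ℕ} (F : Fin N → MvPolynomial (Fin N) ℝ)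
    (π : MvPolynomial (Fin n ⊕ Fin N) ℝ) : MvPolynomial (Fin n ⊕ Fin N) ℝ :=
  ∑ i : Fin N, pderiv (Sum.inr i) π * rename Sum.inr (F i)

/-! ### The POST algorithm -/

/-- `r_j = π^(j) mod G`, computed in `ℝ[a, x]`. -/
def postRemainder {n N : ℕ} (F : Fin N → MvPolynomial (Fin N) ℝ)
    (M : MonomialOrder (Fin n ⊕ Fin N)) (G : Set (MvPolynomial (Fin N) ℝ))
    (π : MvPolynomial (Fin n ⊕ Fin N) ℝ) (j : ℕ) : MvPolynomial (Fin n ⊕ Fin N) ℝ :=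
  remainder M (rename Sum.inr '' G) ((templateLie F)^[j] π)

/-- `V_i`, the set of the valuations `v` with `r_j[v] = 0` for `j = 0, …, i`. -/
def postV {n N : ℕ} (F : Fin N → MvPolynomial (Fin N) ℝ)
    (M : MonomialOrder (Fin n ⊕ Fin N)) (G : Set (MvPolynomial (Fin N) ℝ))
    (π : MvPolynomial (Fin n ⊕ Fin N) ℝ) (i : ℕ) : Set (Fin n → ℝ) :=
  {v | ∀ j ≤ i, instantiate (postRemainder F M G π j) v = 0}

/-- `J_i`, the ideal generated by the sets `π^(j)[V_i]` for `j = 0, …, i`. -/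
def postJ {n N : ℕ} (F : Fin N → MvPolynomial (Fin N) ℝ)
    (M : MonomialOrder (Fin n ⊕ Fin N)) (G : Set (MvPolynomial (Fin N) ℝ))
    (π : MvPolynomial (Fin n ⊕ Fin N) ℝ) (i : ℕ) : Ideal (MvPolynomial (Fin N) ℝ) :=
  Ideal.span (⋃ j ≤ i, instantiate ((templateLie F)^[j] π) '' postV F M G π i)

/-- The algorithm stops and returns `(V, J) = (V_m, J_m)`, where `m` is the least integer such that
`V_{m+1} = V_m` and `J_{m+1} = J_m`. Here `G` is the Gröbner basis of the ideal of the
precondition that is used in the divisions. -/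
def IsPostOutput {n N : ℕ} (F : Fin N → MvPolynomial (Fin N) ℝ)
    (M : MonomialOrder (Fin n ⊕ Fin N)) (G : Set (MvPolynomial (Fin N) ℝ))
    (π : MvPolynomial (Fin n ⊕ Fin N) ℝ)
    (V : Set (Fin n → ℝ)) (J : Ideal (MvPolynomial (Fin N) ℝ)) : Prop :=
  ∃ m : ℕ,
    IsLeast {m | postV F M G π (m + 1) = postV F M G π m ∧
      postJ F M G π (m + 1) = postJ F M G π m} m ∧
    V = postV F M G π m ∧ J = postJ F M G π m

end

end PolyODE

namespace PolyODE

noncomputable section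

/-! ### The Lie derivative on `ℝ[x]` and instantiation of templates -/

/-! Write L for the Lie derivative and I for the ideal of ψ. Since G involves only x, instantiating
a remainder keeps it reduced, so r_j[v] = 0 iff L^j(π[v]) ∈ I (`instantiate_remainder_eq_zero_iff`).
Hence the V_i are a decreasing chain of linear subspaces of ℝⁿ; once it is constant the J_i
increase, and Hilbert's basis theorem gives m.

At m, Leibniz makes J stable under L (`lieD_mem_postJ`). For p ∈ J and a zero x₀ of J, all (L^k
p)(x₀) vanish. These are, up to k!, the Taylor coefficients of p along the trajectory, whose series
sums to p(x(t)) on D because evaluation commutes with absolutely convergent sums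
(`lieSeries_mem_and_sum`). So p vanishes along the trajectory.

Conversely, from a point of an invariant inside φ, each π[v] with v ∈ V vanishes along the
trajectory; differentiating at 0 kills every generator L^j(π[v]) of J there. This needs a trajectory
to exist: it is built as the sum of the Lie series, convergent by the bound C·K^k·k! on L^k of a
coordinate (`coeffNorm_iterate_lieD_le`). -/

/-- The Lie derivative along `F`, as a derivation of `ℝ[x]`. -/
def lieD {N : ℕ} (F : Fin N → MvPolynomial (Fin N) ℝ) :
    Derivation ℝ (MvPolynomial (Fin N) ℝ) (MvPolynomial (Fin N) ℝ) :=
  mkDerivation ℝ F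

theorem derivation_sum_apply {ι σ : Type*} (s : Finset ι)
    (D : ι → Derivation ℝ (MvPolynomial σ ℝ) (MvPolynomial σ ℝ)) (p : MvPolynomial σ ℝ) :
    (∑ i ∈ s, D i) p = ∑ i ∈ s, D i p := by
  have h := map_sum (Derivation.coeFnAddMonoidHom (R := ℝ) (A := MvPolynomial σ ℝ)
    (M := MvPolynomial σ ℝ)) D s
  exact (congrFun h p).trans (Finset.sum_apply _ _ _)

theorem lieD_eq_sum {N : ℕ} (F : Fin N → MvPolynomial (Fin N) ℝ) (p : MvPolynomial (Fin N) ℝ) :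
    lieD F p = ∑ i, pderiv i p * F i := by
  have h : lieD F = ∑ i, F i • (pderiv i : Derivation ℝ (MvPolynomial (Fin N) ℝ) _) := by
    apply MvPolynomial.derivation_ext
    intro j
    rw [lieD, mkDerivation_X, derivation_sum_apply]
    simp [pderiv_X, Pi.single_apply]
  rw [h, derivation_sum_apply]
  simp [mul_comm]

theorem pderiv_instantiate {n N : ℕ} (π : MvPolynomial (Fin n ⊕ Fin N) ℝ) (v : Fin n → ℝ)
    (i : Fin N) :
    instantiate (pderiv (Sum.inr i) π) v = pderiv i (instantiate π v) := by
  induction π using MvPolynomial.induction_on with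
  | C a => simp [instantiate]
  | add p q hp hq => simp only [instantiate, map_add] at *; rw [hp, hq]
  | mul_X p k hp =>
    simp only [instantiate, Derivation.leibniz, map_add, map_mul, smul_eq_mul, aeval_X] at *
    rw [hp]
    rcases k with k | k
    · simp [pderiv_X]
    · by_cases h : k = i
      · subst h; simp
      · have h' : (Sum.inr k : Fin n ⊕ Fin N) ≠ Sum.inr i := by simpa using h
        simp [pderiv_X_of_ne h, pderiv_X_of_ne h']

theorem instantiate_rename_inr {n N : ℕ} (p : MvPolynomial (Fin N) ℝ) (v : Fin n → ℝ) :
    instantiate (rename Sum.inr p) v = p := by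
  rw [instantiate, aeval_rename, Sum.elim_comp_inr, aeval_X_left_apply]

theorem instantiate_templateLie {n N : ℕ} (F : Fin N → MvPolynomial (Fin N) ℝ)
    (π : MvPolynomial (Fin n ⊕ Fin N) ℝ) (v : Fin n → ℝ) :
    instantiate (templateLie F π) v = lieD F (instantiate π v) := by
  rw [lieD_eq_sum]
  have h : instantiate (templateLie F π) v =
      ∑ i, instantiate (pderiv (Sum.inr i) π) v * instantiate (rename Sum.inr (F i)) v := by
    simp only [instantiate, templateLie, map_sum, map_mul]
  rw [h]
  simp only [pderiv_instantiate, instantiate_rename_inr]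

theorem instantiate_iterate_templateLie {n N : ℕ} (F : Fin N → MvPolynomial (Fin N) ℝ)
    (π : MvPolynomial (Fin n ⊕ Fin N) ℝ) (v : Fin n → ℝ) (j : ℕ) :
    instantiate ((templateLie F)^[j] π) v = (lieD F)^[j] (instantiate π v) := by
  induction j with
  | zero => rfl
  | succ j ih =>
    rw [Function.iterate_succ_apply', instantiate_templateLie, ih, Function.iterate_succ_apply']

theorem instantiate_monomial {n N : ℕ} (c : Fin n ⊕ Fin N →₀ ℕ) (a : ℝ) (v : Fin n → ℝ) :
    instantiate (monomial c a) v =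
      monomial (c.comapDomain Sum.inr Sum.inr_injective.injOn)
        (a * ∏ i, v i ^ c (Sum.inl i)) := by
  rw [instantiate, aeval_monomial, Finsupp.prod_fintype _ _ (by simp), Fintype.prod_sum_type,
    monomial_eq, Finsupp.prod_fintype _ _ (by simp)]
  simp [algebraMap_eq, mul_assoc]

/-- Shows that the monomials of π[v] are x-parts of monomials of π, which serves both linearity in v
and the reducedness of instantiated remainders. -/
theorem instantiate_eq_sum {n N : ℕ} (π : MvPolynomial (Fin n ⊕ Fin N) ℝ) (v : Fin n → ℝ) :
    instantiate π v = ∑ c ∈ π.support,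
      monomial (c.comapDomain Sum.inr Sum.inr_injective.injOn)
        (coeff c π * ∏ i, v i ^ c (Sum.inl i)) := by
  conv_lhs => rw [π.as_sum]
  simp only [← instantiate_monomial]
  simp only [instantiate, map_sum]

/-- Instantiation of a template is linear in the parameters. -/
theorem IsTemplate.exists_linearMap {n N : ℕ} {π : MvPolynomial (Fin n ⊕ Fin N) ℝ}
    (hπ : IsTemplate π) :
    ∃ T : (Fin n → ℝ) →ₗ[ℝ] MvPolynomial (Fin N) ℝ, ∀ v, T v = instantiate π v := by
  have key : ∀ c ∈ π.support, ∃ l : (Fin n → ℝ) →ₗ[ℝ] ℝ, ∀ v,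
      ∏ i, v i ^ c (Sum.inl i) = l v := by
    intro c hc
    have h1 := hπ c hc
    -- Parameter exponents summing to 1 are a single 1 and zeros, so the product is the coordinate
    -- `v i₀`.
    obtain ⟨i₀, -, h0⟩ : ∃ i ∈ Finset.univ, c (Sum.inl i) ≠ 0 :=
      Finset.exists_ne_zero_of_sum_ne_zero (by rw [h1]; exact one_ne_zero)
    refine ⟨LinearMap.proj i₀, fun v => ?_⟩
    rw [← Finset.add_sum_erase _ _ (Finset.mem_univ i₀)] at h1
    have h2 : c (Sum.inl i₀) = 1 := by omega
    have h3 : ∑ i ∈ Finset.univ.erase i₀, c (Sum.inl i) = 0 := by omega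
    rw [Finset.sum_eq_zero_iff] at h3
    rw [← Finset.mul_prod_erase _ _ (Finset.mem_univ i₀), h2, pow_one,
      Finset.prod_eq_one (fun i hi => by rw [h3 i hi, pow_zero]), mul_one, LinearMap.proj_apply]
  choose! l hl using key
  refine ⟨∑ c ∈ π.support, (monomial (c.comapDomain Sum.inr Sum.inr_injective.injOn)).comp
    (coeff c π • l c), fun v => ?_⟩
  rw [instantiate_eq_sum, LinearMap.sum_apply]
  refine Finset.sum_congr rfl fun c hc => ?_
  rw [hl c hc]
  simp

/-! ### Division in `ℝ[a, x]` by a Gröbner basis in `ℝ[x]` -/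

theorem degree_rename_inr {n N : ℕ} (M : MonomialOrder (Fin n ⊕ Fin N))
    {g : MvPolynomial (Fin N) ℝ} (hg : g ≠ 0) :
    M.degree (rename Sum.inr g) = ((restrictOrder M).degree g).mapDomain Sum.inr := by
  classical
  apply M.toSyn.injective
  apply le_antisymm
  · rw [M.degree_le_iff]
    intro c hc
    rw [support_rename_of_injective Sum.inr_injective, Finset.mem_image] at hc
    obtain ⟨d, hd, rfl⟩ := hc
    exact (restrictOrder M).le_degree hd
  · apply M.le_degree
    rw [support_rename_of_injective Sum.inr_injective]
    exact Finset.mem_image_of_mem _ ((restrictOrder M).degree_mem_support hg)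

/-- Modulo I, f[v] and r[v] agree because the divisors do not involve the parameters. Moreover r[v]
is still reduced, hence its own remainder with zero quotients, so it lies in I only if it is 0. -/
theorem instantiate_remainder_eq_zero_iff {n N : ℕ} (M : MonomialOrder (Fin n ⊕ Fin N))
    {G : Set (MvPolynomial (Fin N) ℝ)} {I : Ideal (MvPolynomial (Fin N) ℝ)}
    (hG : IsGroebnerBasis (restrictOrder M) G I) (f : MvPolynomial (Fin n ⊕ Fin N) ℝ)
    (v : Fin n → ℝ) :
    instantiate (remainder M (rename Sum.inr '' G) f) v = 0 ↔ instantiate f v ∈ I := by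
  classical
  obtain ⟨h, hf, -, hred⟩ := (exists_isRemainder M (rename Sum.inr '' G) f).choose_spec
  change f = _ + remainder M (rename Sum.inr '' G) f at hf
  set r := remainder M (rename Sum.inr '' G) f with hr
  have hmem : instantiate f v - instantiate r v ∈ I := by
    have : instantiate f v - instantiate r v = instantiate (f - r) v := by
      simp only [instantiate, map_sub]
    rw [this, hf, add_sub_cancel_right, Finsupp.linearCombination_apply, Finsupp.sum]
    simp only [instantiate, map_sum, smul_eq_mul, map_mul]
    refine I.sum_mem fun g _ => I.mul_mem_left _ ?_
    obtain ⟨-, g, hg, rfl⟩ := g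
    change instantiate (rename Sum.inr g) v ∈ I
    rw [instantiate_rename_inr, ← hG.span_eq]
    exact Ideal.subset_span hg
  have hself : IsRemainder (restrictOrder M) G (instantiate r v) (instantiate r v) := by
    refine ⟨0, by simp, fun g => ?_, fun d hd g hg hg0 hle => ?_⟩
    · rw [Finsupp.zero_apply, mul_zero, (restrictOrder M).degree_zero, map_zero]
      exact (restrictOrder M).zero_le _
    · rw [instantiate_eq_sum] at hd
      obtain ⟨c, hc, hdc⟩ := Finset.mem_biUnion.1 (support_sum hd)
      have hdc' := Finset.mem_singleton.1 (support_monomial_subset hdc)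
      refine hred c hc (rename Sum.inr g) ⟨g, hg, rfl⟩
        (by rwa [Ne, map_eq_zero_iff _ (rename_injective _ Sum.inr_injective)]) ?_
      rw [degree_rename_inr M hg0]
      -- The leading monomial of g has exponent 0 at every parameter, so divisibility is decided on
      -- the x-part.
      rintro (i | i)
      · rw [Finsupp.mapDomain_of_notMem_range _ _ (by simp)]
        exact Nat.zero_le _
      · rw [Finsupp.mapDomain_apply Sum.inr_injective]
        have := hle i
        rwa [hdc', Finsupp.comapDomain_apply] at this
  rw [← hG.mem_iff _ _ hself]
  exact ⟨fun H => by simpa using I.add_mem hmem H, fun H => by simpa using I.sub_mem H hmem⟩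

/-! ### Termination and correctness of the chain -/

section Post

variable {n N : ℕ} {F : Fin N → MvPolynomial (Fin N) ℝ} {M : MonomialOrder (Fin n ⊕ Fin N)}
  {G : Set (MvPolynomial (Fin N) ℝ)} {I : Ideal (MvPolynomial (Fin N) ℝ)}
  {π : MvPolynomial (Fin n ⊕ Fin N) ℝ}

theorem mem_postV_iff (hG : IsGroebnerBasis (restrictOrder M) G I) {i : ℕ} {v : Fin n → ℝ} :
    v ∈ postV F M G π i ↔ ∀ j ≤ i, (lieD F)^[j] (instantiate π v) ∈ I := by
  simp only [postV, Set.mem_ofPred_eq, postRemainder, instantiate_remainder_eq_zero_iff M hG,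
    instantiate_iterate_templateLie]

theorem postV_antitone : Antitone (postV F M G π) :=
  fun _ _ h _ hv j hj => hv j (hj.trans h)

/-- Each V_i is an intersection of preimages of I under the linear maps v ↦ L^j(π[v]), hence a
subspace of a finite-dimensional space. -/
theorem exists_postV_eq (hG : IsGroebnerBasis (restrictOrder M) G I) (hπ : IsTemplate π) :
    ∃ k, ∀ i, k ≤ i → postV F M G π i = postV F M G π k := by
  obtain ⟨T, hT⟩ := hπ.exists_linearMap
  let L : Module.End ℝ (MvPolynomial (Fin N) ℝ) := (lieD F : _ →ₗ[ℝ] _)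
  let W : ℕ → Submodule ℝ (Fin n → ℝ) := fun i =>
    ⨅ j ≤ i, (I.restrictScalars ℝ).comap ((L ^ j).comp T)
  have hW : ∀ i, (W i : Set (Fin n → ℝ)) = postV F M G π i := by
    intro i
    ext v
    rw [mem_postV_iff hG]
    simp only [W, L, SetLike.mem_coe, Submodule.mem_iInf, Submodule.mem_comap,
      Submodule.restrictScalars_mem, LinearMap.comp_apply, Module.End.pow_apply, hT]
    rfl
  have hmono : Antitone W := fun i j h => by
    rw [← SetLike.coe_subset_coe, hW, hW]
    exact postV_antitone h
  obtain ⟨k, hk⟩ := IsArtinian.monotone_stabilizes (R := ℝ) (M := Fin n → ℝ)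
    ⟨fun i => OrderDual.toDual (W i), fun i j h => hmono h⟩
  refine ⟨k, fun i hi => ?_⟩
  rw [← hW, ← hW]
  exact congrArg _ (OrderDual.toDual.injective (hk i hi)).symm

theorem exists_isPostOutput (hG : IsGroebnerBasis (restrictOrder M) G I) (hπ : IsTemplate π) :
    ∃ V J, IsPostOutput F M G π V J := by
  obtain ⟨k, hk⟩ := exists_postV_eq (F := F) hG hπ
  -- J_i need not increase while V_i shrinks; freezing the valuations at V_k gives a monotone chain
  -- that agrees with J_i for i ≥ k.
  let K : ℕ →o Ideal (MvPolynomial (Fin N) ℝ) :=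
    ⟨fun i => Ideal.span (⋃ j ≤ i, instantiate ((templateLie F)^[j] π) '' postV F M G π k),
      fun a b h => Ideal.span_mono
        (Set.biUnion_subset_biUnion_left fun _ (hj : _ ≤ a) => hj.trans h)⟩
  have hK : ∀ i, k ≤ i → postJ F M G π i = K i := fun i hi => by
    rw [postJ, hk i hi]; rfl
  obtain ⟨l, hl⟩ := monotone_stabilizes_iff_noetherian.2
    (inferInstance : IsNoetherian (MvPolynomial (Fin N) ℝ) (MvPolynomial (Fin N) ℝ)) K
  have hne : {m | postV F M G π (m + 1) = postV F M G π m ∧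
      postJ F M G π (m + 1) = postJ F M G π m}.Nonempty := by
    refine ⟨max k l, ?_, ?_⟩
    · rw [hk (max k l + 1) (by omega), hk (max k l) (by omega)]
    · rw [hK (max k l + 1) (by omega), hK (max k l) (by omega), ← hl (max k l + 1) (by omega),
        ← hl (max k l) (by omega)]
  exact ⟨_, _, sInf _, ⟨Nat.sInf_mem hne, fun _ h => Nat.sInf_le h⟩, rfl, rfl⟩

/-- The two coincidences `V_{m+1} = V_m` and `J_{m+1} = J_m` make `J_m` closed under the Lie
derivative. -/
theorem lieD_mem_postJ {m : ℕ} (hV : postV F M G π (m + 1) = postV F M G π m)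
    (hJ : postJ F M G π (m + 1) = postJ F M G π m) {p : MvPolynomial (Fin N) ℝ}
    (hp : p ∈ postJ F M G π m) : lieD F p ∈ postJ F M G π m := by
  have hp' := hp
  rw [postJ] at hp
  induction hp using Submodule.span_induction with
  | mem p h =>
    simp only [Set.mem_iUnion] at h
    obtain ⟨j, hj, v, hv, rfl⟩ := h
    -- L sends the generator π^(j)[v] to π^(j+1)[v], a generator of J_{m+1} since v also lies in
    -- V_{m+1}.
    rw [← instantiate_templateLie, ← Function.iterate_succ_apply' (templateLie F), ← hJ]
    refine Ideal.subset_span ?_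
    simp only [Set.mem_iUnion]
    exact ⟨j + 1, by omega, v, by rwa [hV], rfl⟩
  | zero => simp
  | add p q hp hq ihp ihq => rw [map_add]; exact add_mem (ihp hp) (ihq hq)
  | smul a p hp ih =>
    rw [smul_eq_mul, Derivation.leibniz, smul_eq_mul, smul_eq_mul]
    exact add_mem (Ideal.mul_mem_left _ _ (ih hp)) (Ideal.mul_mem_right _ _ hp)

theorem iterate_lieD_mem_postJ {m : ℕ} (hV : postV F M G π (m + 1) = postV F M G π m)
    (hJ : postJ F M G π (m + 1) = postJ F M G π m) {p : MvPolynomial (Fin N) ℝ}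
    (hp : p ∈ postJ F M G π m) (k : ℕ) : (lieD F)^[k] p ∈ postJ F M G π m := by
  induction k with
  | zero => exact hp
  | succ k ih => rw [Function.iterate_succ_apply']; exact lieD_mem_postJ hV hJ ih

end Post

/-! ### Power series that converge absolutely at a point -/

/-- The power series that converge absolutely at `t`. -/
def absConvergent (t : ℝ) : Subalgebra ℝ (PowerSeries ℝ) where
  carrier := {f | Summable fun k => ‖PowerSeries.coeff k f * t ^ k‖}
  mul_mem' {f g} hf hg := by
    have := summable_norm_sum_mul_antidiagonal_of_summable_norm hf hg
    refine this.congr fun k => ?_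
    rw [PowerSeries.coeff_mul, Finset.sum_mul]
    congr 1
    refine Finset.sum_congr rfl fun kl hkl => ?_
    rw [← Finset.HasAntidiagonal.mem_antidiagonal.1 hkl, pow_add]
    ring
  add_mem' {f g} hf hg := by
    refine (Summable.add hf hg).of_nonneg_of_le (fun _ => norm_nonneg _) fun k => ?_
    rw [map_add, add_mul]
    exact norm_add_le _ _
  algebraMap_mem' r := by
    refine summable_of_ne_finset_zero (s := {0}) fun k hk => ?_
    rw [PowerSeries.algebraMap_apply, PowerSeries.coeff_C, if_neg (by simpa using hk)]
    simp

theorem mem_absConvergent {t : ℝ} {f : PowerSeries ℝ} :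
    f ∈ absConvergent t ↔ Summable fun k => ‖PowerSeries.coeff k f * t ^ k‖ := Iff.rfl

/-- Summation at `t`, as an algebra homomorphism. -/
def sumAt (t : ℝ) : absConvergent t →ₐ[ℝ] ℝ :=
  AlgHom.ofLinearMap
    { toFun := fun f => ∑' k, PowerSeries.coeff k (f : PowerSeries ℝ) * t ^ k
      map_add' := fun f g => by
        rw [← Summable.tsum_add (Summable.of_norm f.2) (Summable.of_norm g.2)]
        exact tsum_congr fun k => by simp [add_mul]
      map_smul' := fun r f => by
        rw [RingHom.id_apply, smul_eq_mul, ← tsum_mul_left]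
        exact tsum_congr fun k => by simp [mul_assoc] }
    (by
      change ∑' k, PowerSeries.coeff k ((1 : absConvergent t) : PowerSeries ℝ) * t ^ k = 1
      rw [tsum_eq_single 0 fun k hk => by simp [PowerSeries.coeff_one, hk]]
      simp)
    (fun f g => by
      change ∑' k, PowerSeries.coeff k ((f * g : absConvergent t) : PowerSeries ℝ) * t ^ k =
        (∑' k, PowerSeries.coeff k (f : PowerSeries ℝ) * t ^ k) *
        (∑' k, PowerSeries.coeff k (g : PowerSeries ℝ) * t ^ k)
      rw [tsum_mul_tsum_eq_tsum_sum_antidiagonal_of_summable_norm f.2 g.2]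
      refine tsum_congr fun k => ?_
      rw [MulMemClass.coe_mul, PowerSeries.coeff_mul, Finset.sum_mul]
      refine Finset.sum_congr rfl fun kl hkl => ?_
      rw [← Finset.HasAntidiagonal.mem_antidiagonal.1 hkl, pow_add]
      ring)

theorem sumAt_apply {t : ℝ} (f : absConvergent t) :
    sumAt t f = ∑' k, PowerSeries.coeff k (f : PowerSeries ℝ) * t ^ k := rfl

/-! ### The Lie series -/

/-- The exponential series `∑ (L^k p)(x₀) / k! T^k` of the Lie derivative along `F`. -/
def lieSeries {N : ℕ} (F : Fin N → MvPolynomial (Fin N) ℝ) (x₀ : Fin N → ℝ)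
    (p : MvPolynomial (Fin N) ℝ) : PowerSeries ℝ :=
  PowerSeries.mk fun k => eval x₀ ((lieD F)^[k] p) / (k.factorial : ℝ)

section LieSeries

variable {N : ℕ} (F : Fin N → MvPolynomial (Fin N) ℝ) (x₀ : Fin N → ℝ)

theorem coeff_lieSeries (p : MvPolynomial (Fin N) ℝ) (k : ℕ) :
    PowerSeries.coeff k (lieSeries F x₀ p) = eval x₀ ((lieD F)^[k] p) / (k.factorial : ℝ) :=
  PowerSeries.coeff_mk _ _

theorem lieSeries_add (p q : MvPolynomial (Fin N) ℝ) :
    lieSeries F x₀ (p + q) = lieSeries F x₀ p + lieSeries F x₀ q := by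
  ext k
  rw [map_add, coeff_lieSeries, coeff_lieSeries, coeff_lieSeries, iterate_map_add, map_add, add_div]

theorem lieSeries_C (a : ℝ) : lieSeries F x₀ (C a) = PowerSeries.C a := by
  ext k
  rw [coeff_lieSeries, PowerSeries.coeff_C]
  rcases k with _ | k
  · simp
  · rw [Function.iterate_succ_apply, ← algebraMap_eq, Derivation.map_algebraMap, iterate_map_zero]
    simp

theorem succ_mul_coeff_lieSeries (p : MvPolynomial (Fin N) ℝ) (k : ℕ) :
    PowerSeries.coeff (k + 1) (lieSeries F x₀ p) * ((k : ℝ) + 1) =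
      PowerSeries.coeff k (lieSeries F x₀ (lieD F p)) := by
  rw [coeff_lieSeries, coeff_lieSeries, Function.iterate_succ_apply, Nat.factorial_succ]
  have := Nat.factorial_ne_zero k
  push_cast
  field_simp

theorem derivative_lieSeries (p : MvPolynomial (Fin N) ℝ) :
    PowerSeries.derivative ℝ (lieSeries F x₀ p) = lieSeries F x₀ (lieD F p) := by
  ext k
  rw [PowerSeries.coeff_derivative, succ_mul_coeff_lieSeries]

/-- L becomes d/dT on series, and both are derivations. Coefficient k+1 is determined by coefficient
k of the derivative, so induction over all pairs p, q replaces the iterated Leibniz formula. -/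
theorem lieSeries_mul (p q : MvPolynomial (Fin N) ℝ) :
    lieSeries F x₀ (p * q) = lieSeries F x₀ p * lieSeries F x₀ q := by
  ext k
  induction k generalizing p q with
  | zero =>
    rw [PowerSeries.coeff_mul]
    simp [coeff_lieSeries]
  | succ k ih =>
    have hk : ((k : ℝ) + 1) ≠ 0 := by positivity
    apply mul_right_cancel₀ hk
    rw [succ_mul_coeff_lieSeries, ← PowerSeries.coeff_derivative, Derivation.leibniz,
      Derivation.leibniz, derivative_lieSeries, derivative_lieSeries, lieSeries_add]
    simp only [smul_eq_mul, map_add, ih]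

/-- The Lie series as an algebra homomorphism. -/
def lieSeriesHom : MvPolynomial (Fin N) ℝ →ₐ[ℝ] PowerSeries ℝ where
  toFun := lieSeries F x₀
  map_one' := by rw [← C_1, lieSeries_C, map_one]
  map_mul' := lieSeries_mul F x₀
  map_zero' := by rw [← C_0, lieSeries_C, map_zero]
  map_add' := lieSeries_add F x₀
  commutes' := lieSeries_C F x₀

variable {F x₀}

/-- If the Lie series of the coordinates converge absolutely at `t`, then so does the Lie series of
every polynomial `p`, and its sum is the value of `p` at the sums for the coordinates. -/
theorem lieSeries_mem_and_sum {t : ℝ} (h : ∀ i, lieSeries F x₀ (X i) ∈ absConvergent t)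
    (p : MvPolynomial (Fin N) ℝ) :
    lieSeries F x₀ p ∈ absConvergent t ∧
      ∑' k, PowerSeries.coeff k (lieSeries F x₀ p) * t ^ k =
        eval (fun i => ∑' k, PowerSeries.coeff k (lieSeries F x₀ (X i)) * t ^ k) p := by
  -- Both claims reduce to the variables: algebra homomorphisms out of ℝ[x] are compared there,
  -- first into power series, then into ℝ.
  let Φ : MvPolynomial (Fin N) ℝ →ₐ[ℝ] absConvergent t := aeval fun i => ⟨_, h i⟩
  have h1 : (absConvergent t).val.comp Φ = lieSeriesHom F x₀ := by
    apply MvPolynomial.algHom_ext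
    intro i
    simp only [Φ, AlgHom.comp_apply, aeval_X]
    rfl
  have h2 : lieSeries F x₀ p = (Φ p : PowerSeries ℝ) := (DFunLike.congr_fun h1 p).symm
  refine ⟨h2 ▸ (Φ p).2, ?_⟩
  rw [h2, ← sumAt_apply]
  change ((sumAt t).comp Φ) p = _
  rw [← coe_aeval_eq_eval]
  change _ = aeval (R := ℝ) _ p
  congr 1
  apply MvPolynomial.algHom_ext
  intro i
  simp [Φ, sumAt_apply]

end LieSeries

/-! ### Solutions of the differential equation -/

section Solution

variable {N : ℕ} {F : Fin N → MvPolynomial (Fin N) ℝ} {x : ℝ → Fin N → ℝ}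

theorem hasDerivAt_eval_comp {t : ℝ} (hx : HasDerivAt x (fun i => eval (x t) (F i)) t)
    (p : MvPolynomial (Fin N) ℝ) :
    HasDerivAt (fun s => eval (x s) p) (eval (x t) (lieD F p)) t := by
  induction p using MvPolynomial.induction_on with
  | C a => simpa [lieD] using hasDerivAt_const t a
  | add p q hp hq => simpa using hp.fun_add hq
  | mul_X p i hp =>
    have := hp.fun_mul (hasDerivAt_pi.1 hx i)
    rw [Derivation.leibniz, lieD, mkDerivation_X, ← lieD]
    simp only [map_mul, map_add, smul_eq_mul, eval_X]
    refine this.congr_deriv ?_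
    ring

theorem isOpen_abs_lt (R : ENNReal) : IsOpen {t : ℝ | ENNReal.ofReal |t| < R} :=
  isOpen_lt (ENNReal.continuous_ofReal.comp continuous_abs) continuous_const

theorem iteratedDeriv_eval_comp {R : ENNReal}
    (hx : ∀ t : ℝ, ENNReal.ofReal |t| < R → HasDerivAt x (fun i => eval (x t) (F i)) t)
    (p : MvPolynomial (Fin N) ℝ) (k : ℕ) {t : ℝ} (ht : ENNReal.ofReal |t| < R) :
    iteratedDeriv k (fun s => eval (x s) p) t = eval (x t) ((lieD F)^[k] p) := by
  induction k generalizing t with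
  | zero => simp
  | succ k ih =>
    rw [iteratedDeriv_succ, Function.iterate_succ_apply']
    have hev : iteratedDeriv k (fun s => eval (x s) p) =ᶠ[nhds t]
        fun s => eval (x s) ((lieD F)^[k] p) :=
      Filter.eventuallyEq_of_mem ((isOpen_abs_lt R).mem_nhds ht) fun s hs => ih hs
    rw [hev.deriv_eq]
    exact (hasDerivAt_eval_comp (hx t ht) _).deriv

/-- Translates the Taylor conditions of `IsTimeTrajectory` into conditions on Lie series. -/
theorem iteratedDeriv_div_factorial_eq_coeff {R : ENNReal} (hR : 0 < R)
    (hx : ∀ t : ℝ, ENNReal.ofReal |t| < R → HasDerivAt x (fun i => eval (x t) (F i)) t)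
    (i : Fin N) (k : ℕ) :
    iteratedDeriv k (fun s => x s i) 0 / (k.factorial : ℝ) =
      PowerSeries.coeff k (lieSeries F (x 0) (X i)) := by
  have := iteratedDeriv_eval_comp hx (X i) k (t := 0) (by simpa using hR)
  simp only [eval_X] at this
  rw [coeff_lieSeries, this]

variable {x₀ : Fin N → ℝ} {R : ENNReal}

/-- Along a trajectory from a common zero of all Lie derivatives of `p`, `p` vanishes. -/
theorem IsTimeTrajectory.eval_eq_zero (h : IsTimeTrajectory F x₀ R x)
    {p : MvPolynomial (Fin N) ℝ} (hp : ∀ k, eval x₀ ((lieD F)^[k] p) = 0) {t : ℝ}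
    (ht : ENNReal.ofReal |t| < R) : eval (x t) p = 0 := by
  have hs : ∀ i, HasSum (fun k => PowerSeries.coeff k (lieSeries F x₀ (X i)) * t ^ k) (x t i) := by
    intro i
    have := h.taylor t ht i
    simpa only [iteratedDeriv_div_factorial_eq_coeff h.pos h.ode, h.init] using this
  -- For real series `Summable` already means absolute convergence.
  obtain ⟨-, hsum⟩ := lieSeries_mem_and_sum (fun i => (hs i).summable.norm) p
  simp only [(hs _).tsum_eq] at hsum
  rw [← hsum]
  simp [coeff_lieSeries, hp]

/-- If `p` vanishes along a trajectory, all its Lie derivatives vanish at the initial point. -/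
theorem IsTimeTrajectory.eval_iterate_lieD_eq_zero (h : IsTimeTrajectory F x₀ R x)
    {p : MvPolynomial (Fin N) ℝ} (hp : ∀ t : ℝ, ENNReal.ofReal |t| < R → eval (x t) p = 0) (k : ℕ) :
    eval x₀ ((lieD F)^[k] p) = 0 := by
  have h0 : ENNReal.ofReal |(0 : ℝ)| < R := by simpa using h.pos
  rw [← h.init, ← iteratedDeriv_eval_comp h.ode p k h0]
  have hev : (fun s => eval (x s) p) =ᶠ[nhds 0] fun _ => (0 : ℝ) :=
    Filter.eventuallyEq_of_mem ((isOpen_abs_lt R).mem_nhds h0) hp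
  rw [hev.iteratedDeriv_eq]
  simp

end Solution

/-! ### Growth of the iterated Lie derivatives -/

/-- The weighted `ℓ¹` norm of the coefficients of `p`. -/
def coeffNorm {σ : Type*} (r : ℝ) (p : MvPolynomial σ ℝ) : ℝ :=
  ∑ m ∈ p.support, |coeff m p| * r ^ m.degree

section CoeffNorm

variable {σ : Type*} {r : ℝ}

theorem coeffNorm_eq_of_subset {p : MvPolynomial σ ℝ} {s : Finset (σ →₀ ℕ)} (h : p.support ⊆ s) :
    coeffNorm r p = ∑ m ∈ s, |coeff m p| * r ^ m.degree :=
  Finset.sum_subset h fun m _ hm => by rw [notMem_support_iff.1 hm]; simp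

theorem coeffNorm_nonneg (hr : 0 ≤ r) (p : MvPolynomial σ ℝ) : 0 ≤ coeffNorm r p :=
  Finset.sum_nonneg fun _ _ => by positivity

theorem coeffNorm_monomial (m : σ →₀ ℕ) (a : ℝ) :
    coeffNorm r (monomial m a) = |a| * r ^ m.degree := by
  classical
  rw [coeffNorm_eq_of_subset support_monomial_subset, Finset.sum_singleton, coeff_monomial,
    if_pos rfl]

theorem coeffNorm_add_le (hr : 0 ≤ r) (p q : MvPolynomial σ ℝ) :
    coeffNorm r (p + q) ≤ coeffNorm r p + coeffNorm r q := by
  classical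
  rw [coeffNorm_eq_of_subset (support_add (p := p) (q := q)),
    coeffNorm_eq_of_subset (p := p) Finset.subset_union_left,
    coeffNorm_eq_of_subset (p := q) Finset.subset_union_right, ← Finset.sum_add_distrib]
  refine Finset.sum_le_sum fun m _ => ?_
  rw [coeff_add, ← add_mul]
  gcongr
  exact abs_add_le _ _

theorem coeffNorm_sum_le (hr : 0 ≤ r) {ι : Type*} (s : Finset ι) (f : ι → MvPolynomial σ ℝ) :
    coeffNorm r (∑ i ∈ s, f i) ≤ ∑ i ∈ s, coeffNorm r (f i) :=
  Finset.le_sum_of_subadditive _ (by simp [coeffNorm]) (coeffNorm_add_le hr) _ _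

theorem coeffNorm_mul_le (hr : 0 ≤ r) (p q : MvPolynomial σ ℝ) :
    coeffNorm r (p * q) ≤ coeffNorm r p * coeffNorm r q := by
  conv_lhs => rw [p.as_sum, q.as_sum, Finset.sum_mul_sum]
  refine (coeffNorm_sum_le hr _ _).trans ?_
  rw [coeffNorm, coeffNorm, Finset.sum_mul_sum]
  refine Finset.sum_le_sum fun m _ => ?_
  refine (coeffNorm_sum_le hr _ _).trans (Finset.sum_le_sum fun k _ => ?_)
  rw [monomial_mul, coeffNorm_monomial, map_add, pow_add, abs_mul]
  exact le_of_eq (by ring)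

/-- As r ≥ 1, lowering a degree does not raise the weight; the only loss is the exponent brought
down, at most the total degree. -/
theorem coeffNorm_pderiv_le (hr : 1 ≤ r) (i : σ) (p : MvPolynomial σ ℝ) :
    coeffNorm r (pderiv i p) ≤ p.totalDegree * coeffNorm r p := by
  have hr0 : 0 ≤ r := zero_le_one.trans hr
  conv_lhs => rw [p.as_sum, map_sum]
  refine (coeffNorm_sum_le hr0 _ _).trans ?_
  rw [coeffNorm, Finset.mul_sum]
  refine Finset.sum_le_sum fun m hm => ?_
  rw [pderiv_monomial, coeffNorm_monomial, abs_mul, Nat.abs_cast]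
  have h1 : (m i : ℝ) ≤ p.totalDegree := by
    exact_mod_cast (Finsupp.le_degree i m).trans (le_totalDegree hm)
  have h2 : (m - Finsupp.single i 1).degree ≤ m.degree :=
    Finsupp.degree_mono tsub_le_self
  calc |coeff m p| * (m i : ℝ) * r ^ (m - Finsupp.single i 1).degree
      ≤ |coeff m p| * p.totalDegree * r ^ m.degree := by gcongr
    _ = _ := by ring

theorem abs_eval_le_coeffNorm {x : σ → ℝ} (hx : ∀ i, |x i| ≤ r) (p : MvPolynomial σ ℝ) :
    |eval x p| ≤ coeffNorm r p := by
  rw [eval_eq, coeffNorm]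
  refine (Finset.abs_sum_le_sum_abs _ _).trans (Finset.sum_le_sum fun m _ => ?_)
  rw [abs_mul, Finset.abs_prod, Finsupp.degree_apply, ← Finset.prod_pow_eq_pow_sum]
  gcongr with i _
  rw [abs_pow]
  gcongr
  exact hx i

theorem totalDegree_pderiv_le (i : σ) (p : MvPolynomial σ ℝ) :
    (pderiv i p).totalDegree ≤ p.totalDegree := by
  conv_lhs => rw [p.as_sum, map_sum]
  refine (totalDegree_finsetSum _ _).trans (Finset.sup_le fun m hm => ?_)
  rw [pderiv_monomial]
  refine (totalDegree_monomial_le _ _).trans (le_trans ?_ (le_totalDegree hm))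
  exact Finsupp.degree_mono tsub_le_self

end CoeffNorm

section Growth

variable {N : ℕ} (F : Fin N → MvPolynomial (Fin N) ℝ)

theorem totalDegree_iterate_lieD_le (p : MvPolynomial (Fin N) ℝ) (k : ℕ) :
    ((lieD F)^[k] p).totalDegree ≤ p.totalDegree + k * ∑ i, (F i).totalDegree := by
  induction k with
  | zero => simp
  | succ k ih =>
    rw [Function.iterate_succ_apply', lieD_eq_sum]
    refine (totalDegree_finsetSum _ _).trans (Finset.sup_le fun i _ => ?_)
    refine (totalDegree_mul _ _).trans ?_
    have h1 := (totalDegree_pderiv_le i ((lieD F)^[k] p)).trans ih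
    have h2 := Finset.single_le_sum (f := fun i => (F i).totalDegree) (fun _ _ => Nat.zero_le _)
      (Finset.mem_univ i)
    rw [add_mul, one_mul]
    omega

/-- Degrees grow at most linearly under iteration, so the step from k to k+1 costs a constant times
k+1; these factors build up k!. -/
theorem coeffNorm_iterate_lieD_le {r : ℝ} (hr : 1 ≤ r) (p : MvPolynomial (Fin N) ℝ) (k : ℕ) :
    coeffNorm r ((lieD F)^[k] p) ≤
      coeffNorm r p * (((p.totalDegree + ∑ i, (F i).totalDegree : ℕ) : ℝ) *
        ∑ i, coeffNorm r (F i)) ^ k * (k.factorial : ℝ) := by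
  have hr0 : 0 ≤ r := zero_le_one.trans hr
  set d := ∑ i, (F i).totalDegree with hd
  set B := ∑ i, coeffNorm r (F i) with hB
  have hB0 : 0 ≤ B := Finset.sum_nonneg fun i _ => coeffNorm_nonneg hr0 _
  induction k with
  | zero => simp
  | succ k ih =>
    set q := (lieD F)^[k] p with hq
    have hdeg : (q.totalDegree : ℝ) ≤ ((p.totalDegree + d : ℕ) : ℝ) * (k + 1) := by
      have h1 : q.totalDegree ≤ p.totalDegree + k * d := totalDegree_iterate_lieD_le F p k
      have h2 : q.totalDegree ≤ (p.totalDegree + d) * (k + 1) := by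
        refine h1.trans ?_
        rw [add_mul, mul_add, mul_comm k d]
        nlinarith [Nat.zero_le (p.totalDegree * k)]
      exact_mod_cast h2
    have hstep : coeffNorm r (lieD F q) ≤ q.totalDegree * coeffNorm r q * B := by
      rw [lieD_eq_sum, hB, Finset.mul_sum]
      refine (coeffNorm_sum_le hr0 _ _).trans (Finset.sum_le_sum fun i _ => ?_)
      refine (coeffNorm_mul_le hr0 _ _).trans ?_
      exact mul_le_mul_of_nonneg_right (coeffNorm_pderiv_le hr i q) (coeffNorm_nonneg hr0 _)
    have hq0 := coeffNorm_nonneg hr0 q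
    rw [Function.iterate_succ_apply', ← hq]
    calc coeffNorm r (lieD F q) ≤ q.totalDegree * coeffNorm r q * B := hstep
      _ ≤ (((p.totalDegree + d : ℕ) : ℝ) * (k + 1)) * (coeffNorm r p *
          (((p.totalDegree + d : ℕ) : ℝ) * B) ^ k * (k.factorial : ℝ)) * B := by
          gcongr
      _ = _ := by rw [Nat.factorial_succ]; push_cast; ring

/-- The k! of the growth bound cancels the denominator, leaving a geometric series of ratio K|t|. -/
theorem exists_pos_lieSeries_mem_absConvergent (x₀ : Fin N → ℝ) :
    ∃ ρ : ℝ, 0 < ρ ∧ ∀ t : ℝ, |t| < ρ → ∀ i, lieSeries F x₀ (X i) ∈ absConvergent t := by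
  set r : ℝ := 1 + ∑ i, |x₀ i| with hr
  have hr1 : 1 ≤ r := le_add_of_nonneg_right (Finset.sum_nonneg fun _ _ => abs_nonneg _)
  have hx : ∀ i, |x₀ i| ≤ r := fun i =>
    (Finset.single_le_sum (f := fun i => |x₀ i|) (fun _ _ => abs_nonneg _)
      (Finset.mem_univ i)).trans (le_add_of_nonneg_left zero_le_one)
  set K : ℝ := ((1 + ∑ i, (F i).totalDegree : ℕ) : ℝ) * ∑ i, coeffNorm r (F i) with hK
  have hK0 : 0 ≤ K := mul_nonneg (Nat.cast_nonneg _)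
    (Finset.sum_nonneg fun i _ => coeffNorm_nonneg (zero_le_one.trans hr1) _)
  -- K may be 0, hence the radius 1/(K+1).
  refine ⟨(K + 1)⁻¹, by positivity, fun t ht i => ?_⟩
  have hKt : K * |t| < 1 := by
    have h1 : K * |t| ≤ (K + 1) * |t| := by gcongr; linarith
    have h2 : (K + 1) * |t| < (K + 1) * (K + 1)⁻¹ := by gcongr
    rw [mul_inv_cancel₀ (by positivity)] at h2
    linarith
  rw [mem_absConvergent]
  refine ((summable_geometric_of_lt_one (by positivity) hKt).mul_left
    (coeffNorm r (X i : MvPolynomial (Fin N) ℝ))).of_nonneg_of_le (fun _ => norm_nonneg _)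
    fun k => ?_
  have h1 := (abs_eval_le_coeffNorm hx _).trans (coeffNorm_iterate_lieD_le F hr1 (X i) k)
  rw [totalDegree_X, ← hK] at h1
  have hk : (0 : ℝ) < k.factorial := by exact_mod_cast k.factorial_pos
  rw [coeff_lieSeries, Real.norm_eq_abs, abs_mul, abs_div, Nat.abs_cast, abs_pow, mul_pow,
    ← mul_assoc]
  gcongr
  rwa [div_le_iff₀ hk]

end Growth

/-! ### Existence of time trajectories -/

/-- The termwise derivative is the Lie series of Lp, which converges absolutely at r and so
dominates on (-r, r). -/
theorem hasDerivAt_tsum_lieSeries {N : ℕ} {F : Fin N → MvPolynomial (Fin N) ℝ}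
    {x₀ : Fin N → ℝ} {t r : ℝ} (htr : |t| < r)
    (h : ∀ i, lieSeries F x₀ (X i) ∈ absConvergent r) (p : MvPolynomial (Fin N) ℝ) :
    HasDerivAt (fun s : ℝ => ∑' k, PowerSeries.coeff k (lieSeries F x₀ p) * s ^ k)
      (∑' k, PowerSeries.coeff k (lieSeries F x₀ (lieD F p)) * t ^ k) t := by
  have hr0 : 0 < r := (abs_nonneg t).trans_lt htr
  set c : ℕ → ℝ := fun k => PowerSeries.coeff k (lieSeries F x₀ p) with hc
  have hsucc : ∀ k (s : ℝ), c (k + 1) * (((k + 1 : ℕ) : ℝ) * s ^ (k + 1 - 1)) =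
      PowerSeries.coeff k (lieSeries F x₀ (lieD F p)) * s ^ k := by
    intro k s
    rw [← succ_mul_coeff_lieSeries, add_tsub_cancel_right]
    push_cast
    ring
  have hu : Summable fun k : ℕ => ‖c k * ((k : ℝ) * r ^ (k - 1))‖ := by
    rw [← summable_nat_add_iff 1]
    simp only [hsucc]
    exact (lieSeries_mem_and_sum h (lieD F p)).1
  have hle : ∀ (k : ℕ) (s : ℝ), s ∈ Set.Ioo (-r) r →
      ‖c k * ((k : ℝ) * s ^ (k - 1))‖ ≤ ‖c k * ((k : ℝ) * r ^ (k - 1))‖ := by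
    intro k s hs
    rw [norm_mul, norm_mul, norm_mul, norm_mul, norm_pow, norm_pow, Real.norm_eq_abs s,
      Real.norm_eq_abs r, abs_of_pos hr0]
    gcongr
    exact (abs_lt.2 hs).le
  have htmem : t ∈ Set.Ioo (-r) r := abs_lt.1 htr
  have hder := hasDerivAt_tsum_of_isPreconnected (g := fun k (s : ℝ) => c k * s ^ k)
    (g' := fun k (s : ℝ) => c k * ((k : ℝ) * s ^ (k - 1))) hu isOpen_Ioo isPreconnected_Ioo
    (fun k s _ => (hasDerivAt_pow k s).const_mul (c k)) hle
    (y₀ := 0) ⟨by linarith, hr0⟩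
    (summable_of_ne_finset_zero (s := {0}) fun k hk => by
      rw [zero_pow (by simpa using hk), mul_zero]) htmem
  refine hder.congr_deriv ?_
  have hsum : Summable fun k : ℕ => c k * ((k : ℝ) * t ^ (k - 1)) :=
    Summable.of_norm_bounded hu fun k => hle k t htmem
  -- The term k = 0 vanishes; shifting the index removes the truncated exponent k - 1.
  rw [hsum.tsum_eq_zero_add]
  simp only [hsucc]
  simp

/-- The trajectory is the sum of the coordinate Lie series. Its derivative sums the Lie series of
L(x_i) = f_i, which is f_i at x(t) by multiplicativity. -/
theorem exists_isTimeTrajectory {N : ℕ} (F : Fin N → MvPolynomial (Fin N) ℝ) (x₀ : Fin N → ℝ) :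
    ∃ R x, IsTimeTrajectory F x₀ R x := by
  -- The supremum of the admissible radii, possibly infinite, gives the maximal interval; values of
  -- x beyond it are irrelevant.
  set A : Set ENNReal := {S | ∀ t : ℝ, ENNReal.ofReal |t| < S →
    ∀ i, lieSeries F x₀ (X i) ∈ absConvergent t} with hA
  set x : ℝ → Fin N → ℝ := fun t i => ∑' k, PowerSeries.coeff k (lieSeries F x₀ (X i)) * t ^ k
    with hx
  have hconv : ∀ t : ℝ, ENNReal.ofReal |t| < sSup A →
      ∀ i, lieSeries F x₀ (X i) ∈ absConvergent t := by
    intro t ht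
    obtain ⟨S, hS, htS⟩ := lt_sSup_iff.1 ht
    exact hS t htS
  have hpos : 0 < sSup A := by
    obtain ⟨ρ, hρ, h⟩ := exists_pos_lieSeries_mem_absConvergent F x₀
    refine (ENNReal.ofReal_pos.2 hρ).trans_le (le_sSup fun t ht => h t ?_)
    exact (ENNReal.ofReal_lt_ofReal_iff hρ).1 ht
  have hinit : x 0 = x₀ := by
    funext i
    rw [hx]
    simp only
    rw [tsum_eq_single 0 fun k hk => by rw [zero_pow hk, mul_zero], coeff_lieSeries]
    simp
  have hode : ∀ t : ℝ, ENNReal.ofReal |t| < sSup A →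
      HasDerivAt x (fun i => eval (x t) (F i)) t := by
    intro t ht
    obtain ⟨r, hr0, htr, hr⟩ := ENNReal.lt_iff_exists_real_btwn.1 ht
    have htr' : |t| < r := (ENNReal.ofReal_lt_ofReal_iff_of_nonneg (abs_nonneg t)).1 htr
    have hcr := hconv r (by rwa [abs_of_nonneg hr0])
    refine hasDerivAt_pi.2 fun i => (hasDerivAt_tsum_lieSeries htr' hcr (X i)).congr_deriv ?_
    rw [lieD, mkDerivation_X]
    exact (lieSeries_mem_and_sum (hconv t ht) (F i)).2
  have hcoeff := iteratedDeriv_div_factorial_eq_coeff hpos hode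
  rw [hinit] at hcoeff
  refine ⟨sSup A, x, hpos, hinit, hode, fun t ht i => ?_, fun S hS => le_sSup fun t ht i => ?_⟩
  · simp only [hcoeff]
    exact (Summable.of_norm (hconv t ht i)).hasSum
  · have := hS t ht i
    simp only [hcoeff] at this
    exact this.norm

end

end PolyODE

theorem corollary1 {n N : ℕ} (F : Fin N → MvPolynomial (Fin N) ℝ)
    (M : MonomialOrder (Fin n ⊕ Fin N)) (hM : PolyODE.IsEliminationOrder M)
    (ψ : Set (Fin N → ℝ)) (hψ : PolyODE.IsAlgebraicVariety ψ)
    (G : Set (MvPolynomial (Fin N) ℝ))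
    (hG : PolyODE.IsGroebnerBasis (PolyODE.restrictOrder M) G
      (MvPolynomial.vanishingIdeal ℝ ψ))
    (π : MvPolynomial (Fin n ⊕ Fin N) ℝ) (hπ : PolyODE.IsTemplate π) :
    (∃ (V : Set (Fin n → ℝ)) (J : Ideal (MvPolynomial (Fin N) ℝ)),
      PolyODE.IsPostOutput F M G π V J) ∧
    ∀ (V : Set (Fin n → ℝ)) (J : Ideal (MvPolynomial (Fin N) ℝ)),
      PolyODE.IsPostOutput F M G π V J →
      IsGreatest
        {χ : Set (Fin N → ℝ) | PolyODE.IsAlgebraicInvariant F χ ∧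
          χ ⊆ PolyODE.variety (PolyODE.instantiate π '' V)}
        (PolyODE.variety (J : Set (MvPolynomial (Fin N) ℝ))) := by
  refine ⟨PolyODE.exists_isPostOutput hG hπ, ?_⟩
  rintro V J ⟨m, ⟨⟨hV, hJ⟩, -⟩, rfl, rfl⟩
  refine ⟨⟨⟨⟨_, rfl⟩, fun x₀ hx₀ R x hx t ht p hp => ?_⟩, fun x₀ hx₀ => ?_⟩, ?_⟩
  · exact hx.eval_eq_zero (fun k => hx₀ _ (PolyODE.iterate_lieD_mem_postJ hV hJ hp k)) ht
  · rintro _ ⟨v, hv, rfl⟩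
    refine hx₀ _ (Ideal.subset_span ?_)
    simp only [Set.mem_iUnion]
    exact ⟨0, Nat.zero_le _, v, hv, rfl⟩
  · rintro χ ⟨⟨-, hsafe⟩, hχ⟩ x₀ hx₀ p hp
    -- Without an actual trajectory from x₀, invariance of χ would say nothing there.
    obtain ⟨R, x, hx⟩ := PolyODE.exists_isTimeTrajectory F x₀
    rw [SetLike.mem_coe, PolyODE.postJ] at hp
    -- Polynomials vanishing at x₀ form an ideal, so generators suffice.
    refine (Ideal.span_le (I := RingHom.ker (eval x₀))).2 (fun q hq => ?_) hp
    simp only [Set.mem_iUnion] at hq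
    obtain ⟨j, -, v, hv, rfl⟩ := hq
    rw [PolyODE.instantiate_iterate_templateLie]
    exact hx.eval_iterate_lieD_eq_zero
      (fun t ht => hχ (hsafe x₀ hx₀ R x hx t ht) _ ⟨v, hv, rfl⟩) j
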